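/- Let $T,B\in\mathbb Z_{\ge 0}$ (horizon and battery capacity) and $c\ge 0$ (communication cost). For $i\in\{1,2\}$ let $X^i_1,\dots,X^i_T$ be i.i.d. random vectors in $\mathbb R^{n_i}$ with a probability density $\pi_i$ that has finite second moment and is symmetric and unimodal around $a^i\in\mathbb R^{n_i}$, i.e. $\|x-a^i\|\le\|y-a^i\|$ implies $\pi_i(x)\ge\pi_i(y)$. Let $Z_1,\dots,Z_T$ be i.i.d. with values in $\mathbb Z_{\ge0}$ and probability mass function $p_Z$. The processes $(X^1_t)_t$ and $(X^2_t)_t$ are independent of each other, and $(Z_t)_t$ is independent of the pair of them. Write $\mathbf X_t=(X^1_t,X^2_t)$. At each time $t\in\{1,\dots,T\}$ a scheduler chooses $U_t\in\{0,1,2\}$ (send nothing, send $X^1_t$, send $X^2_t$), with $U_t=0$ whenever the battery level $E_t$ is $0$. The battery evolves by $E_1=B$ and $E_{t+1}=\mathcal F(E_t,U_t,Z_t)$, where $\mathcal F(e,u,z)=\min\{e-\mathbb I(u\ne0)+z,\,B\}$. Estimator $i$ observes $Y^i_t=X^i_t$ if $U_t=i$ and $Y^i_t=\varnothing$ otherwise.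 Put $\mathbf Y_t=(Y^1_t,Y^2_t)$. A strategy profile consists of measurable functions $\mathbf f=(f_t)$, $\mathbf g^i=(g^i_t)$ with $$U_t=f_t(\mathbf X_{1:t},E_{1:t},\mathbf Y_{1:t-1}),\qquad \hat X^i_t=g^i_t(Y^i_{1:t}),$$ where $f_t$ satisfies the constraint that $f_t=0$ if $E_t=0$. Its cost is $$\mathcal J(\mathbf f,\mathbf g^1,\mathbf g^2)=\sum_{t=1}^T\mathbb E\Big[\sum_{i=1}^2\|X^i_t-\hat X^i_t\|^2+c\,\mathbb I(U_t\neq0)\Big]\in[0,\infty].$$ Define value functions on the battery levels $e\in\{0,\dots,B\}$ by the backward recursion $V_{T+1}(e)=0$ and, for $t=T,\dots,1$, $$V_t(e)=\inf_{\tilde x,\gamma}\ \mathbb E\big[\rho(\mathbf X,\gamma,\tilde x)+V_{t+1}(\mathcal F(e,\gamma(\mathbf X),Z))\big].$$ Here $\mathbf X=(X^1,X^2)$ has density $\pi_1(x^1)\pi_2(x^2)$, $Z\sim p_Z$ is independent of $\mathbf X$, and the infimum is over $\tilde x=(\tilde x^1,\tilde x^2)\in\mathbb R^{n_1}\times\mathbb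 R^{n_2}$ and all measurable $\gamma:\mathbb R^{n_1}\times\mathbb R^{n_2}\to\{0,1,2\}$ (with $\gamma\equiv0$ if $e=0$). The stage cost $\rho(\mathbf X,\gamma,\tilde x)$ equals $\sum_i\|X^i-\tilde x^i\|^2$ if $\gamma(\mathbf X)=0$, $c+\|X^2-\tilde x^2\|^2$ if $\gamma(\mathbf X)=1$, and $c+\|X^1-\tilde x^1\|^2$ if $\gamma(\mathbf X)=2$. For $1\le e\le B$ and $1\le t\le T$ put $$C^0_{t+1}(e)=\mathbb E\,V_{t+1}(\min\{e+Z,B\}),\qquad C^1_{t+1}(e)=c+\mathbb E\,V_{t+1}(\min\{e-1+Z,B\}).$$ Then $C^0_{t+1}(e)\le C^1_{t+1}(e)<\infty$ for all $1\le e\le B$ and $1\le t\le T$, so that $\tau^\star_t(e)=\sqrt{C^1_{t+1}(e)-C^0_{t+1}(e)}$ is a well-defined real number. Moreover, the following strategy profile $(\mathbf f^\star,\mathbf g^{1\star},\mathbf g^{2\star})$ is globally optimal, that is, $\mathcal J(\mathbf f^\star,\mathbf g^{1\star},\mathbf g^{2\star})\le\mathcal J(\mathbf f,\mathbf g^1,\mathbf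 g^2)$ for every strategy profile $(\mathbf f,\mathbf g^1,\mathbf g^2)$. - Scheduler: $f^\star_t(\mathbf x,0)=0$. For $e\ge1$, $f^\star_t(\mathbf x,e)=0$ if $\max_i\|x^i-a^i\|\le\tau^\star_t(e)$, and $f^\star_t(\mathbf x,e)=\arg\max_i\|x^i-a^i\|$ otherwise (the smallest maximizing index in case of a tie). Here $\mathbf x$ is the current pair of source values and $e$ the current battery level. - Estimators: $g^{i\star}_t(y^i)=y^i$ if a packet is received ($y^i\ne\varnothing$), and $g^{i\star}_t(\varnothing)=a^i$, where $y^i$ is the current observation. -/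

import Mathlib

open MeasureTheory ProbabilityTheory
open scoped ENNReal

namespace RemoteEstimation

/-- Euclidean space `ℝⁿ`. -/
abbrev Vec (n : ℕ) : Type := EuclideanSpace ℝ (Fin n)

/-- Probability density functions on `ℝⁿ`. -/
structure IsPdf {n : ℕ} (π : Vec n → ℝ) : Prop where
  measurable : Measurable π
  nonneg : ∀ x, 0 ≤ π x
  lintegral_eq_one : ∫⁻ x, ENNReal.ofReal (π x) = 1

/-- A density is symmetric and unimodal around `a` if it does not increase with the
distance to `a`. -/
def SymmetricUnimodal {n : ℕ} (π : Vec n → ℝ) (a : Vec n) : Prop :=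
  ∀ x y : Vec n, ‖x - a‖ ≤ ‖y - a‖ → π y ≤ π x

/-- The law on `ℝⁿ` with density `π`. -/
noncomputable def law {n : ℕ} (π : Vec n → ℝ) : Measure (Vec n) :=
  volume.withDensity (fun x => ENNReal.ofReal (π x))

/-- What an estimator observes in one time slot: `Sum.inl x` is the packet `x`, and
`Sum.inr ()` is the symbol `∅` (nothing received). -/
abbrev Packet (n : ℕ) : Type := Vec n ⊕ Unit

/-- The observation of the estimator of sensor `i` when the source has value `x` and the
scheduling decision is `u`. Decisions are elements of `Fin 3`: `0` sends nothing, and `1`, `2`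
send the measurement of the first and of the second sensor. -/
def observe {n : ℕ} (i : Fin 3) (x : Vec n) (u : Fin 3) : Packet n :=
  if u = i then Sum.inl x else Sum.inr ()

/-- Battery dynamics `min (e - 𝟙(u ≠ 0) + z) B` for capacity `B`, level `e`, decision `u` and
harvested energy `z`. (For feasible decisions, `u ≠ 0` only if `e > 0`, so that the
subtraction is exact.) -/
def battery (B e : ℕ) (u : Fin 3) (z : ℕ) : ℕ :=
  min (e - (if u = 0 then 0 else 1) + z) B

/-- A scheduling strategy `(f_t)`: measurable functions of all source values up to time `t`,
all battery levels up to time `t` and all packets up to time `t - 1`, which send nothing when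
the current battery level is zero. Time is counted from `0`. -/
structure SchedulingStrategy (n₁ n₂ : ℕ) where
  act : (t : ℕ) → (Fin (t + 1) → Vec n₁ × Vec n₂) → (Fin (t + 1) → ℕ) →
    (Fin t → Packet n₁ × Packet n₂) → Fin 3
  measurable_act : ∀ t, Measurable
    fun h : (Fin (t + 1) → Vec n₁ × Vec n₂) × (Fin (t + 1) → ℕ) ×
      (Fin t → Packet n₁ × Packet n₂) => act t h.1 h.2.1 h.2.2
  feasible : ∀ t x e y, e (Fin.last t) = 0 → act t x e y = 0

/-- An estimation strategy `(g_t)`: measurable functions of all observations of the estimator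
up to time `t`. -/
structure EstimationStrategy (n : ℕ) where
  est : (t : ℕ) → (Fin (t + 1) → Packet n) → Vec n
  measurable_est : ∀ t, Measurable (est t)

section ClosedLoop

variable {n₁ n₂ : ℕ}

/-- Battery levels up to time `t` and packets up to time `t - 1` that result from the strategy
`f`, started with a full battery, along the source values `x` and the harvested energies `z`. -/
def history (B : ℕ) (f : SchedulingStrategy n₁ n₂) (x : ℕ → Vec n₁ × Vec n₂) (z : ℕ → ℕ) :
    (t : ℕ) → (Fin (t + 1) → ℕ) × (Fin t → Packet n₁ × Packet n₂)
  | 0 => (fun _ => B, Fin.elim0)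
  | t + 1 =>
    let h := history B f x z t
    let u := f.act t (fun s => x s) h.1 h.2
    (Fin.snoc (α := fun _ => ℕ) h.1 (battery B (h.1 (Fin.last t)) u (z t)),
      Fin.snoc (α := fun _ => Packet n₁ × Packet n₂) h.2
        (observe 1 (x t).1 u, observe 2 (x t).2 u))

/-- The decision `U_t` that results from `f` along `x` and `z`. -/
def decision (B : ℕ) (f : SchedulingStrategy n₁ n₂) (x : ℕ → Vec n₁ × Vec n₂) (z : ℕ → ℕ)
    (t : ℕ) : Fin 3 :=
  f.act t (fun s => x s) (history B f x z t).1 (history B f x z t).2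

/-- The cost of one time slot for source values `x`, estimates `w` and decision `u`. -/
noncomputable def stageCost (c : ℝ) (x w : Vec n₁ × Vec n₂) (u : Fin 3) : ℝ :=
  ‖x.1 - w.1‖ ^ 2 + ‖x.2 - w.2‖ ^ 2 + (if u = 0 then 0 else c)

/-- The pair of estimates at time `t`. -/
def estimates (B : ℕ) (f : SchedulingStrategy n₁ n₂) (g₁ : EstimationStrategy n₁)
    (g₂ : EstimationStrategy n₂) (x : ℕ → Vec n₁ × Vec n₂) (z : ℕ → ℕ) (t : ℕ) :
    Vec n₁ × Vec n₂ :=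
  (g₁.est t fun s => observe 1 (x s).1 (decision B f x z s),
    g₂.est t fun s => observe 2 (x s).2 (decision B f x z s))

/-- The cost `J(f, g¹, g²)` over the horizon `T`: the sum over time of the expected stage costs.
The stage costs are nonnegative, and the value `∞` is allowed. -/
noncomputable def cost {Ω : Type*} [MeasurableSpace Ω] (P : Measure Ω) (T B : ℕ) (c : ℝ)
    (X₁ : ℕ → Ω → Vec n₁) (X₂ : ℕ → Ω → Vec n₂) (Z : ℕ → Ω → ℕ)
    (f : SchedulingStrategy n₁ n₂) (g₁ : EstimationStrategy n₁) (g₂ : EstimationStrategy n₂) :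
    ℝ≥0∞ :=
  ∑ t ∈ Finset.range T, ∫⁻ ω, ENNReal.ofReal
    (stageCost c (X₁ t ω, X₂ t ω)
      (estimates B f g₁ g₂ (fun s => (X₁ s ω, X₂ s ω)) (fun s => Z s ω) t)
      (decision B f (fun s => (X₁ s ω, X₂ s ω)) (fun s => Z s ω) t)) ∂P

end ClosedLoop

section DynamicProgram

variable {n₁ n₂ : ℕ}

/-- Instantaneous cost of the dynamic program: the transmitted source is known exactly, and a
source that is not transmitted is estimated by the corresponding component of `w`. -/
noncomputable def dpCost (c : ℝ) (x w : Vec n₁ × Vec n₂) (u : Fin 3) : ℝ :=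
  if u = 0 then ‖x.1 - w.1‖ ^ 2 + ‖x.2 - w.2‖ ^ 2
  else if u = 1 then c + ‖x.2 - w.2‖ ^ 2
  else c + ‖x.1 - w.1‖ ^ 2

/-- The value function of the dynamic program with `k` time slots to go, as a function of the
battery level `e`. The infimum is over the default estimates `w` and the measurable scheduling
prescriptions `γ` that are feasible at level `e`. -/
noncomputable def valueToGo (π₁ : Vec n₁ → ℝ) (π₂ : Vec n₂ → ℝ) (pZ : PMF ℕ) (c : ℝ) (B : ℕ) :
    ℕ → ℕ → ℝ≥0∞
  | 0, _ => 0
  | k + 1, e =>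
    ⨅ (w : Vec n₁ × Vec n₂) (γ : Vec n₁ × Vec n₂ → Fin 3) (_ : Measurable γ)
      (_ : e = 0 → ∀ x, γ x = 0),
      ∫⁻ x, (ENNReal.ofReal (dpCost c x w (γ x)) +
        ∫⁻ z, valueToGo π₁ π₂ pZ c B k (battery B e (γ x) z) ∂pZ.toMeasure)
          ∂((law π₁).prod (law π₂))

/-- The value function `V_t` for the horizon `T`; time is counted from `0`, so that `V_T = 0`. -/
noncomputable def value (π₁ : Vec n₁ → ℝ) (π₂ : Vec n₂ → ℝ) (pZ : PMF ℕ) (c : ℝ) (B T t e : ℕ) :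
    ℝ≥0∞ :=
  valueToGo π₁ π₂ pZ c B (T - t) e

/-- `C⁰_{t+1}(e) = E[V_{t+1}(min {e + Z, B})]`. -/
noncomputable def contIdle (π₁ : Vec n₁ → ℝ) (π₂ : Vec n₂ → ℝ) (pZ : PMF ℕ) (c : ℝ)
    (B T t e : ℕ) : ℝ≥0∞ :=
  ∫⁻ z, value π₁ π₂ pZ c B T (t + 1) (min (e + z) B) ∂pZ.toMeasure

/-- `C¹_{t+1}(e) = c + E[V_{t+1}(min {e - 1 + Z, B})]`, used for `e ≥ 1`. -/
noncomputable def contSend (π₁ : Vec n₁ → ℝ) (π₂ : Vec n₂ → ℝ) (pZ : PMF ℕ) (c : ℝ)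
    (B T t e : ℕ) : ℝ≥0∞ :=
  ENNReal.ofReal c + ∫⁻ z, value π₁ π₂ pZ c B T (t + 1) (min (e - 1 + z) B) ∂pZ.toMeasure

/-- The threshold `τ_t(e) = √(C¹_{t+1}(e) - C⁰_{t+1}(e))`, used for `e ≥ 1`. -/
noncomputable def threshold (π₁ : Vec n₁ → ℝ) (π₂ : Vec n₂ → ℝ) (pZ : PMF ℕ) (c : ℝ)
    (B T t e : ℕ) : ℝ :=
  √((contSend π₁ π₂ pZ c B T t e).toReal - (contIdle π₁ π₂ pZ c B T t e).toReal)

end DynamicProgram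

section ThresholdStrategies

variable {n₁ n₂ : ℕ}

/-- The threshold rule: with an empty battery nothing is sent; otherwise nothing is sent if both
deviations are at most the threshold `τ e`, and else the source with the largest deviation is sent
(the first one in case of a tie). -/
noncomputable def thresholdRule (a₁ : Vec n₁) (a₂ : Vec n₂) (τ : ℕ → ℝ)
    (x : Vec n₁ × Vec n₂) (e : ℕ) : Fin 3 :=
  if e = 0 then 0
  else if max ‖x.1 - a₁‖ ‖x.2 - a₂‖ ≤ τ e then 0
  else if ‖x.2 - a₂‖ ≤ ‖x.1 - a₁‖ then 1
  else 2

theorem measurable_thresholdRule (a₁ : Vec n₁) (a₂ : Vec n₂) (τ : ℕ → ℝ) :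
    Measurable fun h : (Vec n₁ × Vec n₂) × ℕ => thresholdRule a₁ a₂ τ h.1 h.2 := by
  have hτ : Measurable τ := measurable_from_top
  have h1 : Measurable fun h : (Vec n₁ × Vec n₂) × ℕ => ‖h.1.1 - a₁‖ := by fun_prop
  have h2 : Measurable fun h : (Vec n₁ × Vec n₂) × ℕ => ‖h.1.2 - a₂‖ := by fun_prop
  refine Measurable.ite (measurable_snd (measurableSet_singleton 0)) measurable_const ?_
  refine Measurable.ite (measurableSet_le (h1.max h2) (hτ.comp measurable_snd))
    measurable_const ?_
  exact Measurable.ite (measurableSet_le h2 h1) measurable_const measurable_const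

/-- The scheduling strategy that applies at each time `t` the threshold rule with threshold `τ t`
to the current source values and the current battery level. -/
noncomputable def thresholdScheduler (a₁ : Vec n₁) (a₂ : Vec n₂) (τ : ℕ → ℕ → ℝ) :
    SchedulingStrategy n₁ n₂ where
  act t x e _ := thresholdRule a₁ a₂ (τ t) (x (Fin.last t)) (e (Fin.last t))
  measurable_act t := by
    refine (measurable_thresholdRule a₁ a₂ (τ t)).comp (Measurable.prodMk ?_ ?_)
    · exact (measurable_pi_apply (Fin.last t)).comp measurable_fst
    · exact (measurable_pi_apply (Fin.last t)).comp (measurable_fst.comp measurable_snd)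
  feasible t x e y h := by simp [thresholdRule, h]

/-- The estimation strategy that outputs the received value, and `a` if nothing is received. -/
def defaultEstimator {n : ℕ} (a : Vec n) : EstimationStrategy n where
  est t y := Sum.elim id (fun _ => a) (y (Fin.last t))
  measurable_est t :=
    (measurable_id.sumElim measurable_const).comp (measurable_pi_apply (Fin.last t))

end ThresholdStrategies

end RemoteEstimation

/-! The proof is dynamic programming conditioned on the whole past of sources and energies. This
past contains more than either estimator knows, yet no information is lost. Since `(X_t, Z_t)` is
independent of it with a fixed law, the past affects the future lower bound only through the battery
level.

Lower bound. Once the past is fixed, the estimate of a source that is not sent is a fixed vector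
(`silentEstimates`), and the decision is a measurable function of the current source values
(`nextDecision`). They form an admissible pair in the Bellman infimum, and dropping the error of a
transmitted source only lowers the cost (`dpCost_le_pathCost`). Hence accumulated expected cost plus
expected value to go never decreases in time (`lintegral_valueToGo_succ_le`), and telescoping gives
`value_le_sum`.

Attainment. For default estimates `w`, minimizing over decisions pointwise gives `minCost`, a
function of the two deviations that is monotone in each. A reflection argument
(`lintegral_norm_sub_le`), applied to one source at a time, shows that its expectation is smallest
at `w = a`. There the threshold rule chooses the pointwise minimum: idling costs `r² + s² + C⁰`,
sending the larger deviation costs `min (r²) (s²) + C¹`, and idling is no worse exactly when `max r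
s ^ 2 ≤ C¹ - C⁰`. Thus every inequality of the lower bound can be reversed for the proposed profile.
-/

namespace RemoteEstimation

/-! ### Reflection inequality for symmetric unimodal densities -/

section Density

variable {n : ℕ} {π : Vec n → ℝ}

theorem lintegral_law (hπ : IsPdf π) {φ : Vec n → ℝ≥0∞} (hφ : Measurable φ) :
    ∫⁻ x, φ x ∂law π = ∫⁻ x, ENNReal.ofReal (π x) * φ x := by
  rw [law, lintegral_withDensity_eq_lintegral_mul _ hπ.measurable.ennreal_ofReal hφ]
  rfl

theorem isProbabilityMeasure_law (hπ : IsPdf π) : IsProbabilityMeasure (law π) := by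
  constructor
  rw [law, withDensity_apply _ MeasurableSet.univ, Measure.restrict_univ]
  exact hπ.lintegral_eq_one

/-- The expectation of a nondecreasing function of the distance to `w` is smallest for `w = a`.
The proof compares `x` with its reflection `a + w - x`. -/
theorem lintegral_norm_sub_le {a : Vec n} (hπ : IsPdf π) (hs : SymmetricUnimodal π a)
    {φ : ℝ → ℝ≥0∞} (hφ : MonotoneOn φ (Set.Ici 0)) (hm : Measurable φ) (w : Vec n) :
    ∫⁻ x, φ ‖x - a‖ ∂law π ≤ ∫⁻ x, φ ‖x - w‖ ∂law π := by
  have hn : ∀ b : Vec n, Measurable fun x : Vec n => φ ‖x - b‖ := fun b =>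
    hm.comp (by fun_prop)
  have hp : Measurable fun x => ENNReal.ofReal (π x) := hπ.measurable.ennreal_ofReal
  rw [lintegral_law hπ (hn a), lintegral_law hπ (hn w)]
  have e1 : ∀ x, ‖(a + w - x) - a‖ = ‖x - w‖ := fun x => by
    rw [← norm_neg]; congr 1; abel
  have e2 : ∀ x, ‖(a + w - x) - w‖ = ‖x - a‖ := fun x => by
    rw [← norm_neg]; congr 1; abel
  have r1 : ∫⁻ x, ENNReal.ofReal (π x) * φ ‖x - w‖ =
      ∫⁻ x, ENNReal.ofReal (π (a + w - x)) * φ ‖x - a‖ := by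
    rw [← lintegral_sub_left_eq_self (fun x => ENNReal.ofReal (π x) * φ ‖x - w‖) (a + w)]
    simp only [e2]
  have r2 : ∫⁻ x, ENNReal.ofReal (π x) * φ ‖x - a‖ =
      ∫⁻ x, ENNReal.ofReal (π (a + w - x)) * φ ‖x - w‖ := by
    rw [← lintegral_sub_left_eq_self (fun x => ENNReal.ofReal (π x) * φ ‖x - a‖) (a + w)]
    simp only [e1]
  -- Two-term rearrangement inequality: the reflection swaps the distances to `a` and `w`, and the
  -- density is ordered oppositely to `φ` of the distance to `a`.
  have key : ∀ x, ENNReal.ofReal (π x) * φ ‖x - a‖ + ENNReal.ofReal (π (a + w - x)) * φ ‖x - w‖ ≤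
      ENNReal.ofReal (π x) * φ ‖x - w‖ + ENNReal.ofReal (π (a + w - x)) * φ ‖x - a‖ := by
    intro x
    rcases le_total ‖x - a‖ ‖x - w‖ with h | h
    · have h1 := hφ (norm_nonneg (x - a)) (norm_nonneg (x - w)) h
      have h2 := ENNReal.ofReal_le_ofReal (hs x (a + w - x) (by rwa [e1]))
      rw [add_comm (_ * φ ‖x - w‖)]
      -- Additive witnesses replace differences, which are unsafe in `ℝ≥0∞`; the two sides then
      -- differ by the product `q * p`.
      obtain ⟨p, hp⟩ := exists_add_of_le h1
      obtain ⟨q, hq⟩ := exists_add_of_le h2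
      rw [hp, hq]
      calc _ ≤ _ + q * p := le_self_add
        _ = _ := by ring
    · have h1 := hφ (norm_nonneg (x - w)) (norm_nonneg (x - a)) h
      have h2 := ENNReal.ofReal_le_ofReal (hs (a + w - x) x (by rwa [e1]))
      obtain ⟨p, hp⟩ := exists_add_of_le h1
      obtain ⟨q, hq⟩ := exists_add_of_le h2
      rw [hp, hq]
      calc _ ≤ _ + q * p := le_self_add
        _ = _ := by ring
  have hint := lintegral_mono (μ := volume) key
  rw [lintegral_add_left (by exact hp.mul (hn a)), lintegral_add_left (by exact hp.mul (hn w)),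
    ← r1, ← r2, ← two_mul, ← two_mul] at hint
  exact (ENNReal.mul_le_mul_iff_right two_ne_zero ENNReal.ofNat_ne_top).1 hint

theorem lintegral_norm_sq_law_lt_top (hπ : IsPdf π) (hm : Integrable (fun x => ‖x‖ ^ 2 * π x)) :
    ∫⁻ x, ENNReal.ofReal (‖x‖ ^ 2) ∂law π < ∞ := by
  rw [lintegral_law hπ (by fun_prop)]
  have h := hm.lintegral_lt_top
  refine lt_of_le_of_lt (le_of_eq (lintegral_congr fun x => ?_)) h
  rw [mul_comm, ENNReal.ofReal_mul (by positivity)]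

/-- The centers are moved one coordinate at a time: with the other source frozen this is the
single-source inequality, and Tonelli exchanges the roles. -/
theorem lintegral_prod_norm_sub_le {n₁ n₂ : ℕ} {π₁ : Vec n₁ → ℝ} {π₂ : Vec n₂ → ℝ}
    {a₁ : Vec n₁} {a₂ : Vec n₂} (hπ₁ : IsPdf π₁) (hπ₂ : IsPdf π₂)
    (hs₁ : SymmetricUnimodal π₁ a₁) (hs₂ : SymmetricUnimodal π₂ a₂)
    {h : ℝ → ℝ → ℝ≥0∞} (hm : Measurable fun p : ℝ × ℝ => h p.1 p.2)
    (h₁ : ∀ s, MonotoneOn (fun r => h r s) (Set.Ici 0))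
    (h₂ : ∀ r, MonotoneOn (h r) (Set.Ici 0)) (w : Vec n₁ × Vec n₂) :
    ∫⁻ x, h ‖x.1 - a₁‖ ‖x.2 - a₂‖ ∂((law π₁).prod (law π₂)) ≤
      ∫⁻ x, h ‖x.1 - w.1‖ ‖x.2 - w.2‖ ∂((law π₁).prod (law π₂)) := by
  have := isProbabilityMeasure_law hπ₁
  have := isProbabilityMeasure_law hπ₂
  have hmeas : ∀ b : Vec n₁ × Vec n₂, Measurable
      fun x : Vec n₁ × Vec n₂ => h ‖x.1 - b.1‖ ‖x.2 - b.2‖ := fun b =>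
    hm.comp (f := fun x : Vec n₁ × Vec n₂ => (‖x.1 - b.1‖, ‖x.2 - b.2‖)) (by fun_prop)
  calc _ = ∫⁻ x₁, ∫⁻ x₂, h ‖x₁ - a₁‖ ‖x₂ - a₂‖ ∂law π₂ ∂law π₁ :=
        lintegral_prod _ (hmeas (a₁, a₂)).aemeasurable
    _ ≤ ∫⁻ x₁, ∫⁻ x₂, h ‖x₁ - a₁‖ ‖x₂ - w.2‖ ∂law π₂ ∂law π₁ :=
        lintegral_mono fun x₁ => lintegral_norm_sub_le hπ₂ hs₂ (h₂ _)
          (hm.comp measurable_prodMk_left) _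
    _ = ∫⁻ x₂, ∫⁻ x₁, h ‖x₁ - a₁‖ ‖x₂ - w.2‖ ∂law π₁ ∂law π₂ :=
        lintegral_lintegral_swap (hmeas (a₁, w.2)).aemeasurable
    _ ≤ ∫⁻ x₂, ∫⁻ x₁, h ‖x₁ - w.1‖ ‖x₂ - w.2‖ ∂law π₁ ∂law π₂ :=
        lintegral_mono fun x₂ => lintegral_norm_sub_le hπ₁ hs₁ (h₁ ‖x₂ - w.2‖)
          (hm.comp measurable_prodMk_right) _
    _ = _ := (lintegral_prod_symm _ (hmeas w).aemeasurable).symm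

end Density

/-! ### Solution of the Bellman recursion -/

section DynamicProgramSolution

variable {n₁ n₂ : ℕ} {π₁ : Vec n₁ → ℝ} {π₂ : Vec n₂ → ℝ}

theorem battery_mono (B : ℕ) (u : Fin 3) (z : ℕ) : Monotone fun e => battery B e u z := by
  intro e e' h
  simp only [battery]
  have : e - (if u = 0 then 0 else 1) ≤ e' - (if u = 0 then 0 else 1) := by omega
  omega

/-- A prescription feasible at a lower level stays feasible at a higher one, and the next battery
level is monotone in the current one. -/
theorem valueToGo_antitone (π₁ : Vec n₁ → ℝ) (π₂ : Vec n₂ → ℝ) (pZ : PMF ℕ) (c : ℝ) (B k : ℕ) :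
    Antitone (valueToGo π₁ π₂ pZ c B k) := by
  induction k with
  | zero => exact fun _ _ _ => le_rfl
  | succ k ih =>
    intro e e' h
    simp only [valueToGo]
    refine le_iInf₂ fun w γ => le_iInf₂ fun hγ hf => ?_
    refine (iInf₂_le w γ).trans ((iInf₂_le hγ fun he => hf (by omega)).trans ?_)
    gcongr
    exact ih (battery_mono B _ _ h)

/-- By antitonicity the empty battery is the worst case; there, idling with default estimates `0`
costs the two second moments per slot. -/
theorem valueToGo_lt_top (hπ₁ : IsPdf π₁) (hπ₂ : IsPdf π₂)
    (hm₁ : Integrable (fun x => ‖x‖ ^ 2 * π₁ x)) (hm₂ : Integrable (fun x => ‖x‖ ^ 2 * π₂ x))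
    (pZ : PMF ℕ) (c : ℝ) (B k e : ℕ) : valueToGo π₁ π₂ pZ c B k e < ∞ := by
  have := isProbabilityMeasure_law hπ₁
  have := isProbabilityMeasure_law hπ₂
  suffices h : valueToGo π₁ π₂ pZ c B k 0 < ∞ from
    (valueToGo_antitone π₁ π₂ pZ c B k e.zero_le).trans_lt h
  induction k with
  | zero => simp [valueToGo]
  | succ k ih =>
    rw [valueToGo]
    refine (iInf₂_le 0 fun _ => 0).trans_lt
      ((iInf₂_le measurable_const fun _ _ => rfl).trans_lt ?_)
    calc _ ≤ ∫⁻ x, (ENNReal.ofReal (‖x.1‖ ^ 2) + ENNReal.ofReal (‖x.2‖ ^ 2) +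
            valueToGo π₁ π₂ pZ c B k 0) ∂((law π₁).prod (law π₂)) := by
          refine lintegral_mono fun x => add_le_add ?_ ?_
          · rw [← ENNReal.ofReal_add (by positivity) (by positivity)]
            simp [dpCost]
          · refine (lintegral_mono fun z =>
              valueToGo_antitone π₁ π₂ pZ c B k (Nat.zero_le _)).trans ?_
            simp
      _ < ∞ := by
          rw [lintegral_add_right _ measurable_const, lintegral_add_right _ (by fun_prop),
            lintegral_prod _ (by fun_prop), lintegral_prod _ (by fun_prop)]
          have h₁ := lintegral_norm_sq_law_lt_top hπ₁ hm₁
          have h₂ := lintegral_norm_sq_law_lt_top hπ₂ hm₂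
          simp only [lintegral_const, measure_univ, mul_one]
          exact ENNReal.add_lt_top.2 ⟨ENNReal.add_lt_top.2 ⟨h₁, h₂⟩, ih⟩

theorem lintegral_valueToGo_lt_top (hπ₁ : IsPdf π₁) (hπ₂ : IsPdf π₂)
    (hm₁ : Integrable (fun x => ‖x‖ ^ 2 * π₁ x)) (hm₂ : Integrable (fun x => ‖x‖ ^ 2 * π₂ x))
    (pZ : PMF ℕ) (c : ℝ) (B k : ℕ) (s : ℕ → ℕ) :
    ∫⁻ z, valueToGo π₁ π₂ pZ c B k (s z) ∂pZ.toMeasure < ∞ := by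
  refine (lintegral_mono fun z =>
    valueToGo_antitone π₁ π₂ pZ c B k (Nat.zero_le (s z))).trans_lt ?_
  simpa using valueToGo_lt_top hπ₁ hπ₂ hm₁ hm₂ pZ c B k 0

theorem contIdle_le_contSend (π₁ : Vec n₁ → ℝ) (π₂ : Vec n₂ → ℝ) (pZ : PMF ℕ) (c : ℝ)
    (B T t e : ℕ) : contIdle π₁ π₂ pZ c B T t e ≤ contSend π₁ π₂ pZ c B T t e := by
  refine le_add_left (lintegral_mono fun z => valueToGo_antitone π₁ π₂ pZ c B _ ?_)
  have : e - 1 + z ≤ e + z := by omega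
  omega

theorem contSend_lt_top (hπ₁ : IsPdf π₁) (hπ₂ : IsPdf π₂)
    (hm₁ : Integrable (fun x => ‖x‖ ^ 2 * π₁ x)) (hm₂ : Integrable (fun x => ‖x‖ ^ 2 * π₂ x))
    (pZ : PMF ℕ) (c : ℝ) (B T t e : ℕ) : contSend π₁ π₂ pZ c B T t e < ∞ :=
  ENNReal.add_lt_top.2 ⟨ENNReal.ofReal_lt_top,
    lintegral_valueToGo_lt_top hπ₁ hπ₂ hm₁ hm₂ pZ c B _ _⟩

/-- Minimum over the feasible decisions of the cost of one slot of the dynamic program, as a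
function of the deviations `r`, `s` from the default estimates, where `C₀` and `C₁` are the
continuation costs of idling and of sending. -/
noncomputable def minCost (e : ℕ) (C₀ C₁ : ℝ≥0∞) (r s : ℝ) : ℝ≥0∞ :=
  if e = 0 then ENNReal.ofReal (r ^ 2 + s ^ 2) + C₀
  else min (ENNReal.ofReal (r ^ 2 + s ^ 2) + C₀) (ENNReal.ofReal (min (r ^ 2) (s ^ 2)) + C₁)

theorem measurable_minCost (e : ℕ) (C₀ C₁ : ℝ≥0∞) :
    Measurable fun p : ℝ × ℝ => minCost e C₀ C₁ p.1 p.2 := by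
  unfold minCost
  split_ifs <;> fun_prop

theorem minCost_comm (e : ℕ) (C₀ C₁ : ℝ≥0∞) (r s : ℝ) :
    minCost e C₀ C₁ r s = minCost e C₀ C₁ s r := by
  simp only [minCost, add_comm (r ^ 2), min_comm (r ^ 2)]

theorem monotoneOn_minCost (e : ℕ) (C₀ C₁ : ℝ≥0∞) (r : ℝ) :
    MonotoneOn (minCost e C₀ C₁ r) (Set.Ici 0) := by
  intro s hs s' _ h
  have hs : 0 ≤ s := hs
  unfold minCost
  split_ifs <;> gcongr

/-- Total cost of a decision in one slot of the dynamic program. -/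
noncomputable def slotCost (π₁ : Vec n₁ → ℝ) (π₂ : Vec n₂ → ℝ) (pZ : PMF ℕ) (c : ℝ) (B k e : ℕ)
    (x w : Vec n₁ × Vec n₂) (u : Fin 3) : ℝ≥0∞ :=
  ENNReal.ofReal (dpCost c x w u) + ∫⁻ z, valueToGo π₁ π₂ pZ c B k (battery B e u z) ∂pZ.toMeasure

theorem slotCost_idle (π₁ : Vec n₁ → ℝ) (π₂ : Vec n₂ → ℝ) (pZ : PMF ℕ) (c : ℝ) {T t k : ℕ}
    (hk : T - (t + 1) = k) (B e : ℕ) (x w : Vec n₁ × Vec n₂) :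
    slotCost π₁ π₂ pZ c B k e x w 0 =
      ENNReal.ofReal (‖x.1 - w.1‖ ^ 2 + ‖x.2 - w.2‖ ^ 2) + contIdle π₁ π₂ pZ c B T t e := by
  simp [slotCost, dpCost, battery, contIdle, value, hk]

theorem slotCost_send_fst (π₁ : Vec n₁ → ℝ) (π₂ : Vec n₂ → ℝ) (pZ : PMF ℕ) {c : ℝ} (hc : 0 ≤ c)
    {T t k : ℕ} (hk : T - (t + 1) = k) (B e : ℕ) (x w : Vec n₁ × Vec n₂) :
    slotCost π₁ π₂ pZ c B k e x w 1 =
      ENNReal.ofReal (‖x.2 - w.2‖ ^ 2) + contSend π₁ π₂ pZ c B T t e := by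
  simp only [slotCost, dpCost, battery, contSend, value, hk]
  simp only [one_ne_zero, if_false, if_true]
  rw [ENNReal.ofReal_add hc (by positivity)]
  ring

theorem slotCost_send_snd (π₁ : Vec n₁ → ℝ) (π₂ : Vec n₂ → ℝ) (pZ : PMF ℕ) {c : ℝ} (hc : 0 ≤ c)
    {T t k : ℕ} (hk : T - (t + 1) = k) (B e : ℕ) (x w : Vec n₁ × Vec n₂) :
    slotCost π₁ π₂ pZ c B k e x w 2 =
      ENNReal.ofReal (‖x.1 - w.1‖ ^ 2) + contSend π₁ π₂ pZ c B T t e := by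
  simp only [slotCost, dpCost, battery, contSend, value, hk]
  simp only [show (2 : Fin 3) ≠ 0 by decide, show (2 : Fin 3) ≠ 1 by decide, if_false]
  rw [ENNReal.ofReal_add hc (by positivity)]
  ring

theorem minCost_le_slotCost (π₁ : Vec n₁ → ℝ) (π₂ : Vec n₂ → ℝ) (pZ : PMF ℕ) {c : ℝ} (hc : 0 ≤ c)
    {T t k : ℕ} (hk : T - (t + 1) = k) (B e : ℕ) (x w : Vec n₁ × Vec n₂) (u : Fin 3)
    (hu : e = 0 → u = 0) :
    minCost e (contIdle π₁ π₂ pZ c B T t e) (contSend π₁ π₂ pZ c B T t e)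
      ‖x.1 - w.1‖ ‖x.2 - w.2‖ ≤ slotCost π₁ π₂ pZ c B k e x w u := by
  unfold minCost
  split_ifs with he
  · rw [hu he, slotCost_idle π₁ π₂ pZ c hk]
  · fin_cases u
    · exact (min_le_left _ _).trans (slotCost_idle π₁ π₂ pZ c hk B e x w).ge
    · refine (min_le_right _ _).trans (le_trans ?_ (slotCost_send_fst π₁ π₂ pZ hc hk B e x w).ge)
      gcongr
      exact min_le_right _ _
    · refine (min_le_right _ _).trans (le_trans ?_ (slotCost_send_snd π₁ π₂ pZ hc hk B e x w).ge)
      gcongr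
      exact min_le_left _ _

/-- The common term `min (r²) (s²)` cancels between idling and sending the larger deviation, leaving
the comparison of `max (r²) (s²)` with `C¹ - C⁰`, the square of the threshold. -/
theorem slotCost_thresholdRule_le (hπ₁ : IsPdf π₁) (hπ₂ : IsPdf π₂)
    (hm₁ : Integrable (fun x => ‖x‖ ^ 2 * π₁ x)) (hm₂ : Integrable (fun x => ‖x‖ ^ 2 * π₂ x))
    (pZ : PMF ℕ) {c : ℝ} (hc : 0 ≤ c) {T t k : ℕ} (hk : T - (t + 1) = k) (B e : ℕ)
    (x a : Vec n₁ × Vec n₂) :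
    slotCost π₁ π₂ pZ c B k e x a
        (thresholdRule a.1 a.2 (threshold π₁ π₂ pZ c B T t) x e) ≤
      minCost e (contIdle π₁ π₂ pZ c B T t e) (contSend π₁ π₂ pZ c B T t e)
        ‖x.1 - a.1‖ ‖x.2 - a.2‖ := by
  have hle := contIdle_le_contSend π₁ π₂ pZ c B T t e
  have h1 := contSend_lt_top hπ₁ hπ₂ hm₁ hm₂ pZ c B T t e
  have h0 := hle.trans_lt h1
  have hle' := ENNReal.toReal_mono h1.ne hle
  have e0 := ENNReal.ofReal_toReal h0.ne
  have e1 := ENNReal.ofReal_toReal h1.ne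
  have p0 : 0 ≤ (contIdle π₁ π₂ pZ c B T t e).toReal := ENNReal.toReal_nonneg
  have p1 : 0 ≤ (contSend π₁ π₂ pZ c B T t e).toReal := ENNReal.toReal_nonneg
  have hx1 := norm_nonneg (x.1 - a.1)
  have hx2 := norm_nonneg (x.2 - a.2)
  unfold thresholdRule minCost
  by_cases he : e = 0
  · simp only [he, if_true]
    rw [slotCost_idle π₁ π₂ pZ c hk]
  simp only [he, if_false]
  by_cases hτ : max ‖x.1 - a.1‖ ‖x.2 - a.2‖ ≤ threshold π₁ π₂ pZ c B T t e
  · simp only [hτ, if_true]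
    rw [slotCost_idle π₁ π₂ pZ c hk]
    refine le_min le_rfl ?_
    -- Both continuation costs are finite, so the comparison moves to `ℝ`, where the threshold is
    -- defined by a subtraction.
    rw [← e0, ← e1, ← ENNReal.ofReal_add (by positivity) p0,
      ← ENNReal.ofReal_add (by positivity) p1]
    refine ENNReal.ofReal_le_ofReal ?_
    obtain ⟨h₁, h₂⟩ := max_le_iff.1 hτ
    have h₁ := (Real.le_sqrt hx1 (sub_nonneg.2 hle')).1 h₁
    have h₂ := (Real.le_sqrt hx2 (sub_nonneg.2 hle')).1 h₂
    rcases min_choice (‖x.1 - a.1‖ ^ 2) (‖x.2 - a.2‖ ^ 2) with h | h <;> rw [h] <;> linarith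
  · simp only [hτ, if_false]
    have hlt := Real.lt_sq_of_sqrt_lt (not_le.1 hτ)
    by_cases h : ‖x.2 - a.2‖ ≤ ‖x.1 - a.1‖
    · rw [max_eq_left h] at hlt
      simp only [h, if_true]
      rw [slotCost_send_fst π₁ π₂ pZ hc hk, min_eq_right (pow_le_pow_left₀ hx2 h 2)]
      refine le_min ?_ le_rfl
      rw [← e0, ← e1, ← ENNReal.ofReal_add (by positivity) p0,
        ← ENNReal.ofReal_add (by positivity) p1]
      exact ENNReal.ofReal_le_ofReal (by linarith)
    · simp only [h, if_false]
      have h := (not_le.1 h).le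
      rw [max_eq_right h] at hlt
      rw [slotCost_send_snd π₁ π₂ pZ hc hk, min_eq_left (pow_le_pow_left₀ hx1 h 2)]
      refine le_min ?_ le_rfl
      rw [← e0, ← e1, ← ENNReal.ofReal_add (by positivity) p0,
        ← ENNReal.ofReal_add (by positivity) p1]
      exact ENNReal.ofReal_le_ofReal (by linarith)

/-- The threshold rule together with the default estimates `a` attains the infimum in the
dynamic program. -/
theorem lintegral_slotCost_thresholdRule_le (hπ₁ : IsPdf π₁) (hπ₂ : IsPdf π₂)
    {a₁ : Vec n₁} {a₂ : Vec n₂}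
    (hs₁ : SymmetricUnimodal π₁ a₁) (hs₂ : SymmetricUnimodal π₂ a₂)
    (hm₁ : Integrable (fun x => ‖x‖ ^ 2 * π₁ x)) (hm₂ : Integrable (fun x => ‖x‖ ^ 2 * π₂ x))
    (pZ : PMF ℕ) {c : ℝ} (hc : 0 ≤ c) {T t k : ℕ} (hk : T - (t + 1) = k) (B e : ℕ) :
    ∫⁻ x, slotCost π₁ π₂ pZ c B k e x (a₁, a₂)
        (thresholdRule a₁ a₂ (threshold π₁ π₂ pZ c B T t) x e) ∂((law π₁).prod (law π₂)) ≤
      valueToGo π₁ π₂ pZ c B (k + 1) e := by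
  refine (lintegral_mono fun x =>
    slotCost_thresholdRule_le hπ₁ hπ₂ hm₁ hm₂ pZ hc hk B e x (a₁, a₂)).trans ?_
  rw [valueToGo]
  refine le_iInf₂ fun w γ => le_iInf₂ fun hγ hf => ?_
  refine (lintegral_prod_norm_sub_le hπ₁ hπ₂ hs₁ hs₂ (measurable_minCost e _ _) ?_
    (monotoneOn_minCost e _ _) w).trans (lintegral_mono fun x =>
      minCost_le_slotCost π₁ π₂ pZ hc hk B e x w (γ x) fun he => hf he x)
  intro s
  simp only [minCost_comm e _ _ _ s]
  exact monotoneOn_minCost e _ _ s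

/-- The value function is a lower bound for the cost of every feasible prescription. -/
theorem valueToGo_succ_le_lintegral_slotCost (π₁ : Vec n₁ → ℝ) (π₂ : Vec n₂ → ℝ) (pZ : PMF ℕ)
    (c : ℝ) (B k e : ℕ) (w : Vec n₁ × Vec n₂) {γ : Vec n₁ × Vec n₂ → Fin 3} (hγ : Measurable γ)
    (hf : e = 0 → ∀ x, γ x = 0) :
    valueToGo π₁ π₂ pZ c B (k + 1) e ≤
      ∫⁻ x, slotCost π₁ π₂ pZ c B k e x w (γ x) ∂((law π₁).prod (law π₂)) := by
  rw [valueToGo]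
  exact (iInf₂_le w γ).trans (iInf₂_le hγ hf)

end DynamicProgramSolution

/-! ### Independence of the current slot from the past -/

section Independence

variable {Ω : Type*} [MeasurableSpace Ω] {P : Measure Ω}

/-- Used twice: to join the two sources, then to join the energies to them. -/
theorem iIndepFun_prodMk [IsProbabilityMeasure P] {ι α β : Type*} [Fintype ι] [MeasurableSpace α] [MeasurableSpace β]
    {X : ι → Ω → α} {Y : ι → Ω → β} (hX : ∀ i, Measurable (X i)) (hY : ∀ i, Measurable (Y i))
    (hiX : iIndepFun X P) (hiY : iIndepFun Y P)
    (hXY : IndepFun (fun ω i => X i ω) (fun ω i => Y i ω) P) :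
    iIndepFun (fun i ω => (X i ω, Y i ω)) P := by
  have := fun i => Measure.isProbabilityMeasure_map (μ := P) (hX i).aemeasurable
  have := fun i => Measure.isProbabilityMeasure_map (μ := P) (hY i).aemeasurable
  have hpair : ∀ i, P.map (fun ω => (X i ω, Y i ω)) = (P.map (X i)).prod (P.map (Y i)) := fun i =>
    (indepFun_iff_map_prod_eq_prod_map_map (hX i).aemeasurable (hY i).aemeasurable).1
      (hXY.comp (measurable_pi_apply i) (measurable_pi_apply i))
  rw [iIndepFun_iff_map_fun_eq_pi_map fun i => ((hX i).prodMk (hY i)).aemeasurable]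
  simp only [hpair]
  -- Regrouping a family of pairs as a pair of families turns the product of the pair laws into the
  -- product of the two joint laws.
  let E := MeasurableEquiv.arrowProdEquivProdArrow α β ι
  refine E.map_measurableEquiv_injective ?_
  rw [(measurePreserving_arrowProdEquivProdArrow α β ι _ _).map_eq,
    ← iIndepFun.map_fun_eq_pi_map (fun i => (hX i).aemeasurable) hiX,
    ← iIndepFun.map_fun_eq_pi_map (fun i => (hY i).aemeasurable) hiY,
    ← (indepFun_iff_map_prod_eq_prod_map_map (measurable_pi_lambda _ hX).aemeasurable
      (measurable_pi_lambda _ hY).aemeasurable).1 hXY,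
    Measure.map_map E.measurable (measurable_pi_lambda _ fun i => (hX i).prodMk (hY i))]
  rfl

variable {α : Type*} [MeasurableSpace α] [Zero α]

/-- The sequence `W` before time `t`, continued by `0`. -/
def past (W : ℕ → Ω → α) (t : ℕ) (ω : Ω) (s : ℕ) : α :=
  if s < t then W s ω else 0

theorem measurable_past {W : ℕ → Ω → α} {t : ℕ} (hW : ∀ s < t, Measurable (W s)) :
    Measurable (past W t) := by
  refine measurable_pi_lambda _ fun s => ?_
  by_cases h : s < t
  · simpa only [past, h, if_true] using hW s h
  · simp only [past, h, if_false, measurable_const]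

theorem indepFun_past {W : ℕ → Ω → α} {T t : ℕ} (hW : ∀ s < T, Measurable (W s))
    (hi : iIndepFun (fun s : Fin T => W s) P) (ht : t < T) : IndepFun (past W t) (W t) P := by
  let S : Finset (Fin T) := Finset.univ.filter (·.1 < t)
  let R : Finset (Fin T) := {⟨t, ht⟩}
  have hSR : Disjoint S R := by simp [S, R]
  let φ : (S → α) → ℕ → α := fun v s =>
    if h : s < t then v ⟨⟨s, h.trans ht⟩, by simp [S, h]⟩ else 0
  have hφ : Measurable φ := by
    refine measurable_pi_lambda _ fun s => ?_
    by_cases h : s < t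
    · simp only [φ, h, dif_pos]
      exact measurable_pi_apply _
    · simp only [φ, h, dif_neg, not_false_eq_true, measurable_const]
  have h := (hi.indepFun_finset S R hSR fun s => hW s s.2).comp hφ
    (measurable_pi_apply (⟨⟨t, ht⟩, by simp [R]⟩ : R))
  have e : past W t = φ ∘ fun ω (s : S) => W s ω := by
    ext ω s
    by_cases h : s < t <;> simp [past, φ, h]
  rw [e]
  exact h

/-- The expectation of a function of the path up to time `t`, computed by first averaging over the
value at time `t`. -/
theorem lintegral_path_eq [IsProbabilityMeasure P] {W : ℕ → Ω → α} {T t : ℕ}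
    (hW : ∀ s < T, Measurable (W s))
    (hi : iIndepFun (fun s : Fin T => W s) P) (ht : t < T) {Φ : (ℕ → α) → ℝ≥0∞}
    (hΦ : Measurable Φ) (hc : ∀ p p' : ℕ → α, (∀ s ≤ t, p s = p' s) → Φ p = Φ p') :
    ∫⁻ ω, Φ (fun s => W s ω) ∂P =
      ∫⁻ p, ∫⁻ q, Φ (Function.update p t q) ∂P.map (W t) ∂P.map (past W t) := by
  have hpast : Measurable (past W t) := measurable_past fun s hs => hW s (hs.trans ht)
  have := Measure.isProbabilityMeasure_map (μ := P) (hW t ht).aemeasurable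
  have hm : Measurable fun z : (ℕ → α) × α => Φ (Function.update z.1 t z.2) :=
    hΦ.comp measurable_update'
  rw [← lintegral_prod _ hm.aemeasurable,
    ← (indepFun_iff_map_prod_eq_prod_map_map hpast.aemeasurable (hW t ht).aemeasurable).1
      (indepFun_past hW hi ht), lintegral_map hm (hpast.prodMk (hW t ht))]
  -- Coordinates after `t` differ between the two paths, but `Φ` ignores them; nothing is assumed
  -- about `W` from time `T` on.
  refine lintegral_congr fun ω => hc _ _ fun s hs => ?_
  rcases hs.lt_or_eq with h | rfl
  · simp [Function.update_of_ne h.ne, past, h]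
  · simp

end Independence

/-! ### Causality and measurability of the closed loop -/

section Path

variable {n₁ n₂ : ℕ} (B : ℕ) (f : SchedulingStrategy n₁ n₂)

theorem history_congr {x x' : ℕ → Vec n₁ × Vec n₂} {z z' : ℕ → ℕ} {t : ℕ}
    (hx : ∀ s < t, x s = x' s) (hz : ∀ s < t, z s = z' s) :
    history B f x z t = history B f x' z' t := by
  induction t with
  | zero => rfl
  | succ t ih =>
    have h := ih (fun s hs => hx s (by omega)) (fun s hs => hz s (by omega))
    have hx' : (fun s : Fin (t + 1) => x s) = fun s : Fin (t + 1) => x' s :=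
      funext fun s => hx s s.2
    simp only [history, h, hx', hx t (by omega), hz t (by omega)]

theorem decision_congr {x x' : ℕ → Vec n₁ × Vec n₂} {z z' : ℕ → ℕ} {t : ℕ}
    (hx : ∀ s ≤ t, x s = x' s) (hz : ∀ s < t, z s = z' s) :
    decision B f x z t = decision B f x' z' t := by
  have hx' : (fun s : Fin (t + 1) => x s) = fun s : Fin (t + 1) => x' s :=
    funext fun s => hx s (by omega)
  simp only [decision, hx', history_congr B f (fun s hs => hx s hs.le) hz]

theorem estimates_congr (g₁ : EstimationStrategy n₁) (g₂ : EstimationStrategy n₂)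
    {x x' : ℕ → Vec n₁ × Vec n₂} {z z' : ℕ → ℕ} {t : ℕ}
    (hx : ∀ s ≤ t, x s = x' s) (hz : ∀ s < t, z s = z' s) :
    estimates B f g₁ g₂ x z t = estimates B f g₁ g₂ x' z' t := by
  have h : ∀ s : Fin (t + 1), decision B f x z s = decision B f x' z' s := fun s =>
    decision_congr B f (fun r hr => hx r (by omega)) (fun r hr => hz r (by omega))
  have hx' : ∀ s : Fin (t + 1), x s = x' s := fun s => hx s (by omega)
  simp only [estimates, h, hx']

theorem measurable_observe {n : ℕ} (i : Fin 3) :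
    Measurable fun q : Vec n × Fin 3 => observe i q.1 q.2 :=
  Measurable.ite (measurable_snd (measurableSet_singleton i))
    (measurable_inl.comp measurable_fst) measurable_const

theorem measurable_snoc {α β : Type*} [MeasurableSpace α] [MeasurableSpace β] {t : ℕ}
    {h : α → Fin t → β} {b : α → β} (hh : Measurable h) (hb : Measurable b) :
    Measurable fun p => (Fin.snoc (α := fun _ => β) (h p) (b p) : Fin (t + 1) → β) := by
  refine measurable_pi_lambda _ fun s => ?_
  refine Fin.lastCases ?_ (fun s => ?_) s
  · simpa only [Fin.snoc_last] using hb
  · simpa only [Fin.snoc_castSucc] using measurable_pi_iff.1 hh s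

/-- A path of the source values and the harvested energies. -/
abbrev SourcePath (n₁ n₂ : ℕ) : Type := ℕ → (Vec n₁ × Vec n₂) × ℕ

/-- Stated conditionally because the induction on the history needs the decision at the same time.
-/
theorem measurable_path_decision_of_history {t : ℕ}
    (h : Measurable fun p : SourcePath n₁ n₂ =>
      history B f (fun s => (p s).1) (fun s => (p s).2) t) :
    Measurable fun p : SourcePath n₁ n₂ =>
      decision B f (fun s => (p s).1) (fun s => (p s).2) t :=
  (f.measurable_act t).comp ((measurable_pi_lambda _ fun s : Fin (t + 1) =>
    (measurable_pi_apply (s : ℕ)).fst).prodMk h)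

theorem measurable_path_history (t : ℕ) :
    Measurable fun p : SourcePath n₁ n₂ =>
      history B f (fun s => (p s).1) (fun s => (p s).2) t := by
  induction t with
  | zero => exact measurable_const
  | succ t ih =>
    have hd := measurable_path_decision_of_history B f ih
    have hb : Measurable fun v : (ℕ × Fin 3) × ℕ => battery B v.1.1 v.1.2 v.2 :=
      measurable_of_countable _
    have hp : Measurable fun p : SourcePath n₁ n₂ => p t := measurable_pi_apply t
    refine Measurable.prodMk (measurable_snoc ih.fst ?_) (measurable_snoc ih.snd ?_)
    · exact hb.comp (((((measurable_pi_apply (Fin.last t)).comp ih.fst).prodMk hd)).prodMk hp.snd)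
    · exact ((measurable_observe 1).comp (hp.fst.fst.prodMk hd)).prodMk
        ((measurable_observe 2).comp (hp.fst.snd.prodMk hd))

theorem measurable_path_decision (t : ℕ) :
    Measurable fun p : SourcePath n₁ n₂ =>
      decision B f (fun s => (p s).1) (fun s => (p s).2) t :=
  measurable_path_decision_of_history B f (measurable_path_history B f t)

theorem measurable_path_estimates (g₁ : EstimationStrategy n₁) (g₂ : EstimationStrategy n₂)
    (t : ℕ) : Measurable fun p : SourcePath n₁ n₂ =>
      estimates B f g₁ g₂ (fun s => (p s).1) (fun s => (p s).2) t := by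
  have hp : ∀ s, Measurable fun p : SourcePath n₁ n₂ => p s := fun s => measurable_pi_apply s
  refine ((g₁.measurable_est t).comp (measurable_pi_lambda _ fun s => ?_)).prodMk
    ((g₂.measurable_est t).comp (measurable_pi_lambda _ fun s => ?_))
  · exact (measurable_observe 1).comp ((hp s).fst.fst.prodMk (measurable_path_decision B f s))
  · exact (measurable_observe 2).comp ((hp s).fst.snd.prodMk (measurable_path_decision B f s))

/-- Battery level at time `t` along a path. -/
def pathLevel (p : SourcePath n₁ n₂) (t : ℕ) : ℕ :=
  (history B f (fun s => (p s).1) (fun s => (p s).2) t).1 (Fin.last t)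

/-- Stage cost at time `t` along a path. -/
noncomputable def pathCost (c : ℝ) (g₁ : EstimationStrategy n₁) (g₂ : EstimationStrategy n₂)
    (p : SourcePath n₁ n₂) (t : ℕ) : ℝ≥0∞ :=
  ENNReal.ofReal (stageCost c (p t).1
    (estimates B f g₁ g₂ (fun s => (p s).1) (fun s => (p s).2) t)
    (decision B f (fun s => (p s).1) (fun s => (p s).2) t))

theorem measurable_pathLevel (t : ℕ) :
    Measurable fun p : SourcePath n₁ n₂ => pathLevel B f p t :=
  (measurable_pi_apply (Fin.last t)).comp (measurable_path_history B f t).fst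

theorem measurable_pathCost (c : ℝ) (g₁ : EstimationStrategy n₁) (g₂ : EstimationStrategy n₂)
    (t : ℕ) : Measurable fun p : SourcePath n₁ n₂ => pathCost B f c g₁ g₂ p t := by
  have hp : Measurable fun p : SourcePath n₁ n₂ => p t := measurable_pi_apply t
  have he := measurable_path_estimates B f g₁ g₂ t
  have hd := measurable_path_decision B f t
  refine Measurable.ennreal_ofReal ?_
  refine (((hp.fst.fst.sub he.fst).norm.pow_const 2).add
    ((hp.fst.snd.sub he.snd).norm.pow_const 2)).add ?_
  exact Measurable.ite (hd (measurableSet_singleton 0)) measurable_const measurable_const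

theorem pathLevel_congr {p p' : SourcePath n₁ n₂} {t : ℕ} (h : ∀ s < t, p s = p' s) :
    pathLevel B f p t = pathLevel B f p' t := by
  simp only [pathLevel]
  rw [history_congr B f (fun s hs => congrArg Prod.fst (h s hs))
    fun s hs => congrArg Prod.snd (h s hs)]

theorem pathLevel_succ (p : SourcePath n₁ n₂) (t : ℕ) :
    pathLevel B f p (t + 1) =
      battery B (pathLevel B f p t) (decision B f (fun s => (p s).1) (fun s => (p s).2) t)
        (p t).2 := by
  simp only [pathLevel, history, Fin.snoc_last, decision]

/-- Decision at time `t` after the past `p`, as a function of the current source values. -/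
def nextDecision (p : SourcePath n₁ n₂) (t : ℕ) (x : Vec n₁ × Vec n₂) : Fin 3 :=
  decision B f (fun s => (Function.update p t (x, 0) s).1)
    (fun s => (Function.update p t (x, 0) s).2) t

theorem measurable_nextDecision (p : SourcePath n₁ n₂) (t : ℕ) :
    Measurable (nextDecision B f p t) := by
  refine (measurable_path_decision B f t).comp (g := fun p => _) ?_
  exact (measurable_update p).comp (measurable_id.prodMk measurable_const)

theorem nextDecision_eq_zero {p : SourcePath n₁ n₂} {t : ℕ} (h : pathLevel B f p t = 0)
    (x : Vec n₁ × Vec n₂) : nextDecision B f p t x = 0 := by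
  refine f.feasible t _ _ _ (Eq.trans ?_ h)
  exact pathLevel_congr B f fun s hs => Function.update_of_ne hs.ne _ _

theorem update_fst_eq (p : SourcePath n₁ n₂) (t : ℕ) (q : (Vec n₁ × Vec n₂) × ℕ) (s : ℕ) :
    (Function.update p t q s).1 = (Function.update p t (q.1, 0) s).1 := by
  by_cases h : s = t
  · subst h; simp
  · simp [Function.update_of_ne h]

theorem update_snd_eq (p : SourcePath n₁ n₂) {t : ℕ} (q q' : (Vec n₁ × Vec n₂) × ℕ) {s : ℕ}
    (h : s < t) : (Function.update p t q s).2 = (Function.update p t q' s).2 := by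
  simp [Function.update_of_ne h.ne]

/-- The energy of slot `t` first matters for the battery at `t + 1`, so the filler `0` in
`nextDecision` is harmless. -/
theorem decision_update (p : SourcePath n₁ n₂) (t : ℕ) (q : (Vec n₁ × Vec n₂) × ℕ) :
    decision B f (fun s => (Function.update p t q s).1) (fun s => (Function.update p t q s).2) t =
      nextDecision B f p t q.1 :=
  decision_congr B f (fun s _ => update_fst_eq p t q s) fun _ hs => update_snd_eq p q _ hs

theorem pathLevel_update_succ (p : SourcePath n₁ n₂) (t : ℕ) (q : (Vec n₁ × Vec n₂) × ℕ) :
    pathLevel B f (Function.update p t q) (t + 1) =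
      battery B (pathLevel B f p t) (nextDecision B f p t q.1) q.2 := by
  rw [pathLevel_succ, decision_update, Function.update_self,
    pathLevel_congr B f fun s hs => Function.update_of_ne hs.ne q p]

theorem pathCost_update (c : ℝ) (g₁ : EstimationStrategy n₁) (g₂ : EstimationStrategy n₂)
    (p : SourcePath n₁ n₂) (t : ℕ) (q : (Vec n₁ × Vec n₂) × ℕ) :
    pathCost B f c g₁ g₂ (Function.update p t q) t =
      pathCost B f c g₁ g₂ (Function.update p t (q.1, 0)) t := by
  simp only [pathCost, decision_update, Function.update_self]
  rw [estimates_congr B f g₁ g₂ (fun s _ => update_fst_eq p t q s)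
    fun _ hs => update_snd_eq p q (q.1, 0) hs]

/-- The estimates at time `t` when nothing is received at that time. -/
def silentEstimates (g₁ : EstimationStrategy n₁) (g₂ : EstimationStrategy n₂)
    (p : SourcePath n₁ n₂) (t : ℕ) : Vec n₁ × Vec n₂ :=
  let y : Fin t → Packet n₁ × Packet n₂ := fun s =>
    (observe 1 (p s).1.1 (decision B f (fun s => (p s).1) (fun s => (p s).2) s),
      observe 2 (p s).1.2 (decision B f (fun s => (p s).1) (fun s => (p s).2) s))
  (g₁.est t (Fin.snoc (α := fun _ => Packet n₁) (fun s => (y s).1) (Sum.inr ())),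
    g₂.est t (Fin.snoc (α := fun _ => Packet n₂) (fun s => (y s).2) (Sum.inr ())))

theorem decision_update_of_lt (p : SourcePath n₁ n₂) {t s : ℕ} (hs : s < t)
    (q : (Vec n₁ × Vec n₂) × ℕ) :
    decision B f (fun s => (Function.update p t q s).1) (fun s => (Function.update p t q s).2) s =
      decision B f (fun s => (p s).1) (fun s => (p s).2) s :=
  decision_congr B f (fun r hr => by rw [Function.update_of_ne (by omega)])
    fun r hr => by rw [Function.update_of_ne (by omega)]

/-- Unless its packet is sent, an estimator receives `∅` at time `t`, and its earlier packets are
determined by the past; so the current `x` cannot influence its estimate. -/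
theorem estimates_fst_update (g₁ : EstimationStrategy n₁) (g₂ : EstimationStrategy n₂)
    (p : SourcePath n₁ n₂) (t : ℕ) (x : Vec n₁ × Vec n₂) (h : nextDecision B f p t x ≠ 1) :
    (estimates B f g₁ g₂ (fun s => (Function.update p t (x, 0) s).1)
      (fun s => (Function.update p t (x, 0) s).2) t).1 = (silentEstimates B f g₁ g₂ p t).1 := by
  simp only [estimates, silentEstimates]
  congr 1
  funext s
  refine Fin.lastCases ?_ (fun s => ?_) s
  · simp only [Fin.snoc_last, Fin.val_last, decision_update, observe, h, if_false]
  · simp only [Fin.snoc_castSucc, Fin.val_castSucc, decision_update_of_lt B f p s.2,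
      Function.update_of_ne s.2.ne]

theorem estimates_snd_update (g₁ : EstimationStrategy n₁) (g₂ : EstimationStrategy n₂)
    (p : SourcePath n₁ n₂) (t : ℕ) (x : Vec n₁ × Vec n₂) (h : nextDecision B f p t x ≠ 2) :
    (estimates B f g₁ g₂ (fun s => (Function.update p t (x, 0) s).1)
      (fun s => (Function.update p t (x, 0) s).2) t).2 = (silentEstimates B f g₁ g₂ p t).2 := by
  simp only [estimates, silentEstimates]
  congr 1
  funext s
  refine Fin.lastCases ?_ (fun s => ?_) s
  · simp only [Fin.snoc_last, Fin.val_last, decision_update, observe, h, if_false]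
  · simp only [Fin.snoc_castSucc, Fin.val_castSucc, decision_update_of_lt B f p s.2,
      Function.update_of_ne s.2.ne]

/-- The inequality can be strict only when a source is sent: an arbitrary estimator need not output
the packet it receives. -/
theorem dpCost_le_pathCost (c : ℝ) (g₁ : EstimationStrategy n₁) (g₂ : EstimationStrategy n₂)
    (p : SourcePath n₁ n₂) (t : ℕ) (x : Vec n₁ × Vec n₂) :
    ENNReal.ofReal (dpCost c x (silentEstimates B f g₁ g₂ p t) (nextDecision B f p t x)) ≤
      pathCost B f c g₁ g₂ (Function.update p t (x, 0)) t := by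
  refine ENNReal.ofReal_le_ofReal ?_
  have h₁ := estimates_fst_update B f g₁ g₂ p t x
  have h₂ := estimates_snd_update B f g₁ g₂ p t x
  rw [decision_update, Function.update_self]
  revert h₁ h₂
  generalize nextDecision B f p t x = u
  intro h₁ h₂
  unfold dpCost stageCost
  fin_cases u
  · rw [h₁ (by simp), h₂ (by simp)]
    simp
  · rw [h₂ (by simp)]
    simp only [Fin.mk_one, one_ne_zero, if_false, if_true]
    nlinarith [sq_nonneg ‖x.1 - (estimates B f g₁ g₂ (fun s => (Function.update p t (x, 0) s).1)
      (fun s => (Function.update p t (x, 0) s).2) t).1‖]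
  · rw [h₁ (by simp)]
    simp only [Fin.reduceFinMk, show (2 : Fin 3) ≠ 0 by decide, show (2 : Fin 3) ≠ 1 by decide,
      if_false]
    nlinarith [sq_nonneg ‖x.2 - (estimates B f g₁ g₂ (fun s => (Function.update p t (x, 0) s).1)
      (fun s => (Function.update p t (x, 0) s).2) t).2‖]

theorem pathCost_defaultEstimator (c : ℝ) (a : Vec n₁ × Vec n₂)
    (p : SourcePath n₁ n₂) (t : ℕ) (x : Vec n₁ × Vec n₂) :
    pathCost B f c (defaultEstimator a.1) (defaultEstimator a.2) (Function.update p t (x, 0)) t =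
      ENNReal.ofReal (dpCost c x a (nextDecision B f p t x)) := by
  unfold pathCost
  congr 1
  simp only [estimates, defaultEstimator, Fin.val_last, decision_update, Function.update_self]
  generalize nextDecision B f p t x = u
  unfold dpCost stageCost observe
  fin_cases u <;> simp [add_comm]

theorem nextDecision_thresholdScheduler (a₁ : Vec n₁) (a₂ : Vec n₂) (τ : ℕ → ℕ → ℝ)
    (p : SourcePath n₁ n₂) (t : ℕ) (x : Vec n₁ × Vec n₂) :
    nextDecision B (thresholdScheduler a₁ a₂ τ) p t x =
      thresholdRule a₁ a₂ (τ t) x (pathLevel B (thresholdScheduler a₁ a₂ τ) p t) := by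
  rw [← pathLevel_congr B _ fun s hs => Function.update_of_ne hs.ne (x, 0) p]
  simp [nextDecision, decision, thresholdScheduler, pathLevel]

end Path

/-! ### Verification by telescoping along the closed loop -/

section Optimality

variable {n₁ n₂ : ℕ} {π₁ : Vec n₁ → ℝ} {π₂ : Vec n₂ → ℝ} {Ω : Type*} [MeasurableSpace Ω]
  {P : Measure Ω} {W : ℕ → Ω → (Vec n₁ × Vec n₂) × ℕ} {T t : ℕ}

/-- The expected value to go with `k` slots left, evaluated at the battery level at time `t`. -/
theorem lintegral_valueToGo_pathLevel (hW : ∀ s < T, Measurable (W s)) (pZ : PMF ℕ) (c : ℝ)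
    (B k : ℕ) (f : SchedulingStrategy n₁ n₂) (ht : t ≤ T) :
    ∫⁻ ω, valueToGo π₁ π₂ pZ c B k (pathLevel B f (fun s => W s ω) t) ∂P =
      ∫⁻ p, valueToGo π₁ π₂ pZ c B k (pathLevel B f p t) ∂P.map (past W t) := by
  have hv : Measurable fun p : SourcePath n₁ n₂ => valueToGo π₁ π₂ pZ c B k (pathLevel B f p t) :=
    (measurable_of_countable _).comp (measurable_pathLevel B f t)
  rw [lintegral_map hv (measurable_past fun s hs => hW s (by omega))]
  refine lintegral_congr fun ω => ?_
  rw [pathLevel_congr B f fun s hs => show W s ω = past W t ω s by simp [past, hs]]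

/-- Expected stage cost plus expected value to go, conditioned on the past. -/
theorem lintegral_pathCost_add [IsProbabilityMeasure P] (hπ₁ : IsPdf π₁) (hπ₂ : IsPdf π₂)
    (hW : ∀ s < T, Measurable (W s)) (hi : iIndepFun (fun s : Fin T => W s) P) (pZ : PMF ℕ)
    (hlaw : ∀ s < T, P.map (W s) = ((law π₁).prod (law π₂)).prod pZ.toMeasure) (c : ℝ)
    (B k : ℕ) (f : SchedulingStrategy n₁ n₂) (g₁ : EstimationStrategy n₁)
    (g₂ : EstimationStrategy n₂) (ht : t < T) :
    ∫⁻ ω, pathCost B f c g₁ g₂ (fun s => W s ω) t ∂P +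
        ∫⁻ ω, valueToGo π₁ π₂ pZ c B k (pathLevel B f (fun s => W s ω) (t + 1)) ∂P =
      ∫⁻ p, ∫⁻ x, (pathCost B f c g₁ g₂ (Function.update p t (x, 0)) t +
        ∫⁻ z, valueToGo π₁ π₂ pZ c B k
          (battery B (pathLevel B f p t) (nextDecision B f p t x) z) ∂pZ.toMeasure)
        ∂((law π₁).prod (law π₂)) ∂P.map (past W t) := by
  have := isProbabilityMeasure_law hπ₁
  have := isProbabilityMeasure_law hπ₂
  have hc := measurable_pathCost B f c g₁ g₂ t
  have hv : Measurable fun p : SourcePath n₁ n₂ =>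
      valueToGo π₁ π₂ pZ c B k (pathLevel B f p (t + 1)) :=
    (measurable_of_countable _).comp (measurable_pathLevel B f (t + 1))
  have cc : ∀ p p' : SourcePath n₁ n₂, (∀ s ≤ t, p s = p' s) →
      pathCost B f c g₁ g₂ p t = pathCost B f c g₁ g₂ p' t := fun p p' h => by
    have hx : ∀ s ≤ t, (p s).1 = (p' s).1 := fun s hs => congrArg Prod.fst (h s hs)
    have hz : ∀ s < t, (p s).2 = (p' s).2 := fun s hs => congrArg Prod.snd (h s hs.le)
    simp only [pathCost, h t le_rfl]
    rw [estimates_congr B f g₁ g₂ hx hz, decision_congr B f hx hz]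
  have cv : ∀ p p' : SourcePath n₁ n₂, (∀ s ≤ t, p s = p' s) →
      valueToGo π₁ π₂ pZ c B k (pathLevel B f p (t + 1)) =
        valueToGo π₁ π₂ pZ c B k (pathLevel B f p' (t + 1)) := fun p p' h => by
    rw [pathLevel_congr B f fun s hs => h s (by omega)]
  have hcu : Measurable fun y : SourcePath n₁ n₂ × ((Vec n₁ × Vec n₂) × ℕ) =>
      pathCost B f c g₁ g₂ (Function.update y.1 t y.2) t := hc.comp measurable_update'
  rw [lintegral_path_eq hW hi ht hc cc, lintegral_path_eq hW hi ht hv cv, hlaw t ht,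
    ← lintegral_add_left hcu.lintegral_prod_right']
  refine lintegral_congr fun p => ?_
  dsimp only
  have hcp : Measurable fun q => pathCost B f c g₁ g₂ (Function.update p t q) t :=
    hc.comp (measurable_update p (a := t))
  have hvp : Measurable fun q =>
      valueToGo π₁ π₂ pZ c B k (pathLevel B f (Function.update p t q) (t + 1)) :=
    hv.comp (measurable_update p (a := t))
  -- The harvested energy is integrated innermost; the stage cost does not depend on it and leaves
  -- that integral.
  rw [← lintegral_add_left hcp, lintegral_prod _ (by exact (hcp.add hvp).aemeasurable)]
  refine lintegral_congr fun x => ?_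
  simp only [pathLevel_update_succ]
  rw [lintegral_congr fun z => by rw [pathCost_update]]
  simp only
  rw [lintegral_add_left measurable_const, lintegral_const, measure_univ, mul_one]

theorem lintegral_valueToGo_succ_le [IsProbabilityMeasure P] (hπ₁ : IsPdf π₁) (hπ₂ : IsPdf π₂)
    (hW : ∀ s < T, Measurable (W s)) (hi : iIndepFun (fun s : Fin T => W s) P) (pZ : PMF ℕ)
    (hlaw : ∀ s < T, P.map (W s) = ((law π₁).prod (law π₂)).prod pZ.toMeasure) (c : ℝ)
    (B k : ℕ) (f : SchedulingStrategy n₁ n₂) (g₁ : EstimationStrategy n₁)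
    (g₂ : EstimationStrategy n₂) (ht : t < T) :
    ∫⁻ ω, valueToGo π₁ π₂ pZ c B (k + 1) (pathLevel B f (fun s => W s ω) t) ∂P ≤
      ∫⁻ ω, pathCost B f c g₁ g₂ (fun s => W s ω) t ∂P +
        ∫⁻ ω, valueToGo π₁ π₂ pZ c B k (pathLevel B f (fun s => W s ω) (t + 1)) ∂P := by
  rw [lintegral_pathCost_add hπ₁ hπ₂ hW hi pZ hlaw c B k f g₁ g₂ ht,
    lintegral_valueToGo_pathLevel hW pZ c B (k + 1) f ht.le]
  refine lintegral_mono fun p => ?_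
  -- For the fixed past `p`, the silent estimates and `nextDecision` serve as the competitor `(w,
  -- γ)` in the Bellman infimum.
  refine (valueToGo_succ_le_lintegral_slotCost π₁ π₂ pZ c B k _ (silentEstimates B f g₁ g₂ p t)
    (measurable_nextDecision B f p t) fun h => nextDecision_eq_zero B f h).trans ?_
  exact lintegral_mono fun x => add_le_add_left (dpCost_le_pathCost B f c g₁ g₂ p t x) _

theorem lintegral_thresholdScheduler_le [IsProbabilityMeasure P] (hπ₁ : IsPdf π₁)
    (hπ₂ : IsPdf π₂) {a₁ : Vec n₁} {a₂ : Vec n₂}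
    (hs₁ : SymmetricUnimodal π₁ a₁) (hs₂ : SymmetricUnimodal π₂ a₂)
    (hm₁ : Integrable (fun x => ‖x‖ ^ 2 * π₁ x)) (hm₂ : Integrable (fun x => ‖x‖ ^ 2 * π₂ x))
    (hW : ∀ s < T, Measurable (W s)) (hi : iIndepFun (fun s : Fin T => W s) P) (pZ : PMF ℕ)
    (hlaw : ∀ s < T, P.map (W s) = ((law π₁).prod (law π₂)).prod pZ.toMeasure) {c : ℝ}
    (hc : 0 ≤ c) (B : ℕ) {k : ℕ} (ht : t < T) (hk : T - (t + 1) = k) :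
    ∫⁻ ω, pathCost B (thresholdScheduler a₁ a₂ (threshold π₁ π₂ pZ c B T)) c
          (defaultEstimator a₁) (defaultEstimator a₂) (fun s => W s ω) t ∂P +
        ∫⁻ ω, valueToGo π₁ π₂ pZ c B k (pathLevel B
          (thresholdScheduler a₁ a₂ (threshold π₁ π₂ pZ c B T)) (fun s => W s ω) (t + 1)) ∂P ≤
      ∫⁻ ω, valueToGo π₁ π₂ pZ c B (k + 1) (pathLevel B
        (thresholdScheduler a₁ a₂ (threshold π₁ π₂ pZ c B T)) (fun s => W s ω) t) ∂P := by
  rw [lintegral_pathCost_add hπ₁ hπ₂ hW hi pZ hlaw c B k _ _ _ ht,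
    lintegral_valueToGo_pathLevel hW pZ c B (k + 1) _ ht.le]
  refine lintegral_mono fun p => le_trans (lintegral_mono fun x => ?_)
    (lintegral_slotCost_thresholdRule_le hπ₁ hπ₂ hs₁ hs₂ hm₁ hm₂ pZ hc hk B _)
  rw [pathCost_defaultEstimator B _ c (a₁, a₂), nextDecision_thresholdScheduler]
  exact le_rfl

/-- Every strategy profile costs at least the value at time `0` of a full battery. -/
theorem value_le_sum [IsProbabilityMeasure P] (hπ₁ : IsPdf π₁) (hπ₂ : IsPdf π₂)
    (hW : ∀ s < T, Measurable (W s)) (hi : iIndepFun (fun s : Fin T => W s) P) (pZ : PMF ℕ)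
    (hlaw : ∀ s < T, P.map (W s) = ((law π₁).prod (law π₂)).prod pZ.toMeasure) (c : ℝ)
    (B : ℕ) (f : SchedulingStrategy n₁ n₂) (g₁ : EstimationStrategy n₁)
    (g₂ : EstimationStrategy n₂) :
    value π₁ π₂ pZ c B T 0 B ≤
      ∑ t ∈ Finset.range T, ∫⁻ ω, pathCost B f c g₁ g₂ (fun s => W s ω) t ∂P := by
  -- The right side starts at the value of a full battery and does not decrease with `t`; at `t = T`
  -- the value to go vanishes.
  suffices h : ∀ t ≤ T, value π₁ π₂ pZ c B T 0 B ≤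
      ∑ s ∈ Finset.range t, ∫⁻ ω, pathCost B f c g₁ g₂ (fun s => W s ω) s ∂P +
        ∫⁻ ω, valueToGo π₁ π₂ pZ c B (T - t) (pathLevel B f (fun s => W s ω) t) ∂P by
    simpa [valueToGo] using h T le_rfl
  intro t
  induction t with
  | zero => simp [value, pathLevel, history]
  | succ t ih =>
    intro ht
    have hstep := lintegral_valueToGo_succ_le hπ₁ hπ₂ hW hi pZ hlaw c B (T - (t + 1)) f g₁ g₂ ht
    rw [show T - (t + 1) + 1 = T - t by omega] at hstep
    rw [Finset.sum_range_succ, add_assoc]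
    exact (ih (by omega)).trans (by gcongr)

/-- The threshold strategy with the default estimators costs at most the value at time `0` of a
full battery. -/
theorem sum_thresholdScheduler_le_value [IsProbabilityMeasure P] (hπ₁ : IsPdf π₁)
    (hπ₂ : IsPdf π₂) {a₁ : Vec n₁} {a₂ : Vec n₂}
    (hs₁ : SymmetricUnimodal π₁ a₁) (hs₂ : SymmetricUnimodal π₂ a₂)
    (hm₁ : Integrable (fun x => ‖x‖ ^ 2 * π₁ x)) (hm₂ : Integrable (fun x => ‖x‖ ^ 2 * π₂ x))
    (hW : ∀ s < T, Measurable (W s)) (hi : iIndepFun (fun s : Fin T => W s) P) (pZ : PMF ℕ)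
    (hlaw : ∀ s < T, P.map (W s) = ((law π₁).prod (law π₂)).prod pZ.toMeasure) {c : ℝ}
    (hc : 0 ≤ c) (B : ℕ) :
    ∑ t ∈ Finset.range T, ∫⁻ ω, pathCost B
        (thresholdScheduler a₁ a₂ (threshold π₁ π₂ pZ c B T)) c (defaultEstimator a₁)
        (defaultEstimator a₂) (fun s => W s ω) t ∂P ≤
      value π₁ π₂ pZ c B T 0 B := by
  set f := thresholdScheduler a₁ a₂ (threshold π₁ π₂ pZ c B T) with hf
  -- The same telescoping quantity, which for the threshold profile does not increase with `t`.
  suffices h : ∀ t ≤ T, ∑ s ∈ Finset.range t, ∫⁻ ω, pathCost B f c (defaultEstimator a₁)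
        (defaultEstimator a₂) (fun s => W s ω) s ∂P +
      ∫⁻ ω, valueToGo π₁ π₂ pZ c B (T - t) (pathLevel B f (fun s => W s ω) t) ∂P ≤
        value π₁ π₂ pZ c B T 0 B by
    simpa [valueToGo] using h T le_rfl
  intro t
  induction t with
  | zero => simp [value, pathLevel, history]
  | succ t ih =>
    intro ht
    have hstep := lintegral_thresholdScheduler_le hπ₁ hπ₂ hs₁ hs₂ hm₁ hm₂ hW hi pZ hlaw hc B ht rfl
    rw [show T - (t + 1) + 1 = T - t by omega, ← hf] at hstep
    rw [Finset.sum_range_succ, add_assoc]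
    exact le_trans (by gcongr) (ih (by omega))

end Optimality

end RemoteEstimation

theorem theorem1 {n₁ n₂ : ℕ} (T B : ℕ) (c : ℝ) (hc : 0 ≤ c)
    (π₁ : RemoteEstimation.Vec n₁ → ℝ) (π₂ : RemoteEstimation.Vec n₂ → ℝ)
    (a₁ : RemoteEstimation.Vec n₁) (a₂ : RemoteEstimation.Vec n₂) (pZ : PMF ℕ)
    (hπ₁ : RemoteEstimation.IsPdf π₁) (hπ₂ : RemoteEstimation.IsPdf π₂)
    (hs₁ : RemoteEstimation.SymmetricUnimodal π₁ a₁)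
    (hs₂ : RemoteEstimation.SymmetricUnimodal π₂ a₂)
    (hm₁ : Integrable (fun x => ‖x‖ ^ 2 * π₁ x)) (hm₂ : Integrable (fun x => ‖x‖ ^ 2 * π₂ x))
    {Ω : Type*} [MeasurableSpace Ω] (P : Measure Ω) [IsProbabilityMeasure P]
    (X₁ : ℕ → Ω → RemoteEstimation.Vec n₁) (X₂ : ℕ → Ω → RemoteEstimation.Vec n₂)
    (Z : ℕ → Ω → ℕ)
    (hX₁ : ∀ t < T, Measurable (X₁ t)) (hX₂ : ∀ t < T, Measurable (X₂ t))
    (hZ : ∀ t < T, Measurable (Z t))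
    (hlaw₁ : ∀ t < T, P.map (X₁ t) = RemoteEstimation.law π₁)
    (hlaw₂ : ∀ t < T, P.map (X₂ t) = RemoteEstimation.law π₂)
    (hlawZ : ∀ t < T, P.map (Z t) = pZ.toMeasure)
    (hind₁ : iIndepFun (fun t : Fin T => X₁ t) P)
    (hind₂ : iIndepFun (fun t : Fin T => X₂ t) P)
    (hindZ : iIndepFun (fun t : Fin T => Z t) P)
    (hind₁₂ : IndepFun (fun ω (t : Fin T) => X₁ t ω) (fun ω (t : Fin T) => X₂ t ω) P)
    (hindXZ : IndepFun (fun ω (t : Fin T) => (X₁ t ω, X₂ t ω)) (fun ω (t : Fin T) => Z t ω) P) :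
    (∀ t < T, ∀ e : ℕ, 1 ≤ e → e ≤ B →
      RemoteEstimation.contIdle π₁ π₂ pZ c B T t e ≤
          RemoteEstimation.contSend π₁ π₂ pZ c B T t e ∧
        RemoteEstimation.contSend π₁ π₂ pZ c B T t e < ∞) ∧
    ∀ (f : RemoteEstimation.SchedulingStrategy n₁ n₂)
      (g₁ : RemoteEstimation.EstimationStrategy n₁)
      (g₂ : RemoteEstimation.EstimationStrategy n₂),
      RemoteEstimation.cost P T B c X₁ X₂ Z
          (RemoteEstimation.thresholdScheduler a₁ a₂
            (RemoteEstimation.threshold π₁ π₂ pZ c B T))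
          (RemoteEstimation.defaultEstimator a₁) (RemoteEstimation.defaultEstimator a₂) ≤
        RemoteEstimation.cost P T B c X₁ X₂ Z f g₁ g₂ := by
  refine ⟨fun t _ e _ _ => ⟨RemoteEstimation.contIdle_le_contSend π₁ π₂ pZ c B T t e,
    RemoteEstimation.contSend_lt_top hπ₁ hπ₂ hm₁ hm₂ pZ c B T t e⟩, fun f g₁ g₂ => ?_⟩
  have hX : ∀ t < T, Measurable fun ω => (X₁ t ω, X₂ t ω) := fun t ht =>
    (hX₁ t ht).prodMk (hX₂ t ht)
  let W : ℕ → Ω → (RemoteEstimation.Vec n₁ × RemoteEstimation.Vec n₂) × ℕ :=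
    fun t ω => ((X₁ t ω, X₂ t ω), Z t ω)
  have hW : ∀ t < T, Measurable (W t) := fun t ht => (hX t ht).prodMk (hZ t ht)
  have hiX : iIndepFun (fun (t : Fin T) ω => (X₁ t ω, X₂ t ω)) P :=
    RemoteEstimation.iIndepFun_prodMk (fun t => hX₁ t t.2) (fun t => hX₂ t t.2) hind₁ hind₂ hind₁₂
  have hi : iIndepFun (fun t : Fin T => W t) P :=
    RemoteEstimation.iIndepFun_prodMk (fun t => hX t t.2) (fun t => hZ t t.2) hiX hindZ hindXZ
  have hlaw : ∀ t < T, P.map (W t) = ((RemoteEstimation.law π₁).prod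
      (RemoteEstimation.law π₂)).prod pZ.toMeasure := by
    intro t ht
    have h₁₂ : IndepFun (X₁ t) (X₂ t) P := hind₁₂.comp
      (measurable_pi_apply (⟨t, ht⟩ : Fin T)) (measurable_pi_apply (⟨t, ht⟩ : Fin T))
    have hXZ : IndepFun (fun ω => (X₁ t ω, X₂ t ω)) (Z t) P := hindXZ.comp
      (measurable_pi_apply (⟨t, ht⟩ : Fin T)) (measurable_pi_apply (⟨t, ht⟩ : Fin T))
    rw [← hlaw₁ t ht, ← hlaw₂ t ht, ← hlawZ t ht,
      ← (indepFun_iff_map_prod_eq_prod_map_map (hX₁ t ht).aemeasurable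
        (hX₂ t ht).aemeasurable).1 h₁₂,
      ← (indepFun_iff_map_prod_eq_prod_map_map (hX t ht).aemeasurable
        (hZ t ht).aemeasurable).1 hXZ]
  -- `cost` is by definition the sum of the expected `pathCost` along `W`.
  exact (RemoteEstimation.sum_thresholdScheduler_le_value hπ₁ hπ₂ hs₁ hs₂ hm₁ hm₂ hW hi pZ hlaw
    hc B).trans (RemoteEstimation.value_le_sum hπ₁ hπ₂ hW hi pZ hlaw c B f g₁ g₂)
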